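/- Let $q=2^e$ with $e>1$ an odd integer, and let $\sigma: x\mapsto x^{2^{(e+1)/2}}$ (an automorphism of $\mathrm{GF}(q)$). Let $\delta\in\mathrm{GF}(q)\setminus\{1\}$ have absolute trace $\mathrm{Tr}(\delta)=1$ over $\mathrm{GF}(2)$, let $\varepsilon\in\mathrm{GF}(q^2)\setminus\mathrm{GF}(q)$ satisfy $\varepsilon^2+\varepsilon+\delta=0$, and let $b\in\mathrm{GF}(q^2)\setminus\mathrm{GF}(q)$. Put $$g(x)=\left[((x^q+x)\varepsilon+x)^{\sigma+2}+(x^q+x)^\sigma+((x^q+x)\varepsilon+x)(x^q+x)\right]\varepsilon .$$ Let $\mathfrak{A}'_\varepsilon$ be the incidence structure whose points are the points $(x,y)$ of $\mathrm{AG}(2,q^2)$ and whose lines are the vertical lines $x=k$ together with the curves $\mathcal D(m,d)$ of equation $y=g(x)+bx^{q+1}+mx+d$, where $k,m,d$ range over $\mathrm{GF}(q^2)$. Its projective closure is obtained by adding one point at infinity for each class of parallel lines, and the line consisting of these points; let $Y_\infty$ be the point at infinity of the vertical lines. In the projective closure of $\mathfrak{A}'_\varepsilon$ consider the point set $$\mathcal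 U_b=\{(x,\,bx^{q+1}+r)\mid x\in\mathrm{GF}(q^2),\ r\in\mathrm{GF}(q)\}\cup\{Y_\infty\}.$$ Then there is an isomorphism from the projective closure of $\mathfrak{A}'_\varepsilon$ onto $\mathrm{PG}(2,q^2)$ which maps the affine point $(\xi,\eta+g(\xi)+b\xi^{q+1})$ to $(1,\xi,\eta)$ for all $\xi,\eta\in\mathrm{GF}(q^2)$ and maps $Y_\infty$ to $(0,0,1)$; it maps $\mathcal U_b$ onto $$U_\varepsilon=\{(1,x,g(x)+r)\mid x\in\mathrm{GF}(q^2),\ r\in\mathrm{GF}(q)\}\cup\{(0,0,1)\}.$$ Moreover, $\mathcal U_b$ (that is, $U_\varepsilon$ in the coordinates of $\mathfrak{A}'_\varepsilon$) is a non-classical B-T unital in the projective closure of $\mathfrak{A}'_\varepsilon$. Here a unital in a projective plane of order $q^2$ is a set of $q^3+1$ points that meets every line in $1$ or $q+1$ points. A unital in $\mathrm{PG}(2,q^2)$ is classical if it is the set of absolute points of a non-degenerate unitary polarity. It is a B-T (Buekenhout–Tits) unital if, in the Bruck–Bose representation of $\mathrm{PG}(2,q^2)$ in $\mathrm{PG}(4,q)$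 with respect to some line at infinity, it is represented by a cone which has its vertex in the hyperplane at infinity and as its base a Tits ovoid of a $3$-space not containing the vertex, and which meets the hyperplane at infinity in precisely one line of the spread. A point set in a plane isomorphic to $\mathrm{PG}(2,q^2)$ is called classical, respectively a B-T unital, if some isomorphism onto $\mathrm{PG}(2,q^2)$ maps it to such a unital. -/

import Mathlib

open scoped LinearAlgebra.Projectivization

namespace Unitals

/-! ### Planes given by their point set and the set of their lines -/

/-- A bijection between the point sets of two geometries (given by their sets of lines, each line
being a set of points) is an isomorphism when it carries lines to lines in both directions. -/
def IsIsomorphism {P P' : Type*} (lines : Set (Set P)) (lines' : Set (Set P')) (f : P ≃ P') :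
    Prop :=
  ∀ s : Set P, s ∈ lines ↔ f '' s ∈ lines'

/-- The parallel class of the line `l`: all lines equal to `l` or disjoint from it. -/
def parallelClass {P : Type*} (lines : Set (Set P)) (l : Set P) : Set (Set P) :=
  {m | m ∈ lines ∧ (m = l ∨ Disjoint m l)}

/-- Points of the projective closure of an affine plane: the affine points, and one point at
infinity for each parallel class of lines. -/
abbrev ClosurePoint {P : Type*} (lines : Set (Set P)) : Type _ :=
  P ⊕ {c : Set (Set P) // ∃ l ∈ lines, c = parallelClass lines l}

/-- The affine line `l` completed with its point at infinity. -/
def extendLine {P : Type*} (lines : Set (Set P)) (l : Set P) : Set (ClosurePoint lines) :=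
  {p | (∃ a ∈ l, p = Sum.inl a) ∨ ∃ c, l ∈ c.1 ∧ p = Sum.inr c}

/-- Lines of the projective closure: the completed affine lines and the line at infinity. -/
def closureLines {P : Type*} (lines : Set (Set P)) : Set (Set (ClosurePoint lines)) :=
  {s | (∃ l ∈ lines, s = extendLine lines l) ∨ s = Set.range Sum.inr}

/-- The points of `PG(2,K)`. -/
abbrev PG2 (K : Type*) [Field K] : Type _ := ℙ K (Fin 3 → K)

/-- The lines of `PG(2,K)`: the point sets of the two-dimensional subspaces of `K³`. -/
def pgLines (K : Type*) [Field K] : Set (Set (PG2 K)) :=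
  {s | ∃ W : Submodule K (Fin 3 → K), Module.finrank K W = 2 ∧ s = {p | p.submodule ≤ W}}

/-! ### Unitals -/

/-- A unital in a projective plane of order `q²`: a set of `q³ + 1` points which every line meets
in `1` or `q + 1` points. -/
def IsUnital {P : Type*} (q : ℕ) (lines : Set (Set P)) (U : Set P) : Prop :=
  U.ncard = q ^ 3 + 1 ∧ ∀ l ∈ lines, (l ∩ U).ncard = 1 ∨ (l ∩ U).ncard = q + 1

/-- `U` is the set of absolute points of a non-degenerate unitary polarity of `PG(2,q²)`, the one
given by the invertible Hermitian matrix `H` (with respect to `x ↦ x^q`). -/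
def IsAbsolutePointSet {K : Type*} [Field K] (q : ℕ) (U : Set (PG2 K)) : Prop :=
  ∃ H : Matrix (Fin 3) (Fin 3) K, (∀ i j, H j i = H i j ^ q) ∧ H.det ≠ 0 ∧
    U = {p | ∑ i, ∑ j, p.rep i * H i j * p.rep j ^ q = 0}

/-- A classical unital in a plane isomorphic to `PG(2,q²)`, where `K = GF(q²)`. -/
def IsClassicalUnital (K : Type*) [Field K] {P : Type*} (q : ℕ) (lines : Set (Set P))
    (U : Set P) : Prop :=
  ∃ f : P ≃ PG2 K, IsIsomorphism lines (pgLines K) f ∧ IsAbsolutePointSet q (f '' U)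

/-- `O` is a Tits ovoid in the projective 3-space of the four-dimensional subspace `S` over
`F = GF(2^e)`, `e` odd: in suitable coordinates
`O = {(1, s, t, s^(σ+2) + s t + t^σ)} ∪ {(0,0,0,1)}` with `σ : x ↦ x^(2^((e+1)/2))`. -/
def IsTitsOvoid {F V : Type*} [Field F] [AddCommGroup V] [Module F V] (e : ℕ)
    (S : Submodule F V) (O : Set (ℙ F V)) : Prop :=
  ∃ B : Module.Basis (Fin 4) F S,
    O = {p | p.submodule = Submodule.span F {(B 3 : V)} ∨
      ∃ s t : F, p.submodule = Submodule.span F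
        {(B 0 : V) + s • (B 1 : V) + t • (B 2 : V) +
          (s ^ (2 ^ ((e + 1) / 2) + 2) + s * t + t ^ (2 ^ ((e + 1) / 2))) • (B 3 : V)}}

/-- The cone with vertex `v` and base `O`: all points on the lines joining `v` to points of `O`. -/
def cone {F V : Type*} [Field F] [AddCommGroup V] [Module F V] (v : ℙ F V) (O : Set (ℙ F V)) :
    Set (ℙ F V) :=
  {x | ∃ o ∈ O, x.submodule ≤ v.submodule ⊔ o.submodule}

/-- Buekenhout's construction in the Bruck-Bose representation of `PG(2,K)` in `PG(4,F)`, where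
`F = GF(2^e)` and `K = GF(2^(2e))`.

A line of `PG(2,K)`, that is a plane `W` of `K³`, is chosen as line at infinity, and `v₀ ∉ W`.
The five-dimensional `F`-space `X = W + F v₀` is the space `PG(4,F)`, with hyperplane at infinity
`W`. The one-dimensional `K`-subspaces of `W` are the lines of a regular spread of this hyperplane,
and they are the points at infinity of `PG(2,K)`; a point `⟨x⟩_F` of `PG(4,F)` outside `W`
represents the point `⟨x⟩_K` of `PG(2,K)`.

The unital is the point set represented by a cone of `PG(4,F)` which has its vertex in the
hyperplane at infinity and a Tits ovoid as its base, and which meets the hyperplane at infinity in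
precisely one line of the spread. -/
def IsBTPointSet (F : Type*) {K : Type*} [Field F] [Field K] [Algebra F K] (e : ℕ)
    (U : Set (PG2 K)) : Prop :=
  ∃ (W : Submodule K (Fin 3 → K)) (v₀ : Fin 3 → K) (S : Submodule F (Fin 3 → K))
    (O : Set (ℙ F (Fin 3 → K))) (v : ℙ F (Fin 3 → K)) (L : PG2 K),
    Module.finrank K W = 2 ∧ v₀ ∉ W ∧
    S ≤ W.restrictScalars F ⊔ Submodule.span F {v₀} ∧ IsTitsOvoid e S O ∧
    v.submodule ≤ W.restrictScalars F ∧ ¬ v.submodule ≤ S ∧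
    L.submodule ≤ W ∧
    {x | x ∈ cone v O ∧ x.submodule ≤ W.restrictScalars F} =
      {x | x.submodule ≤ L.submodule.restrictScalars F} ∧
    U = {p | ∃ x ∈ cone v O, x.submodule ≤ p.submodule.restrictScalars F}

/-- A Buekenhout-Tits (B-T) unital in a plane isomorphic to `PG(2,K)`, where `F = GF(2^e)` and
`K = GF(2^(2e))`. -/
def IsBTUnital (F K : Type*) [Field F] [Field K] [Algebra F K] {P : Type*} (e : ℕ)
    (lines : Set (Set P)) (U : Set P) : Prop :=
  IsUnital (2 ^ e) lines U ∧
    ∃ f : P ≃ PG2 K, IsIsomorphism lines (pgLines K) f ∧ IsBTPointSet F e (f '' U)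

/-! ### The affine plane and the point sets of the construction -/

/-- The absolute trace `GF(2^e) → GF(2)`. -/
def absTrace {F : Type*} [Field F] (e : ℕ) (x : F) : F :=
  ∑ i ∈ Finset.range e, x ^ (2 ^ i)

section Plane

variable {K : Type*} [Field K]

/-- `[((x^q+x)ε+x)^(σ+2) + (x^q+x)^σ + ((x^q+x)ε+x)(x^q+x)] ε`, where `q = 2^e` and
`σ : x ↦ x^(2^((e+1)/2))`. -/
def titsTerm (e : ℕ) (ε x : K) : K :=
  (((x ^ (2 ^ e) + x) * ε + x) ^ (2 ^ ((e + 1) / 2) + 2) +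
    (x ^ (2 ^ e) + x) ^ (2 ^ ((e + 1) / 2)) +
    ((x ^ (2 ^ e) + x) * ε + x) * (x ^ (2 ^ e) + x)) * ε

/-- The vertical line `x = k` of `AG(2,K)`. -/
def verticalLine (k : K) : Set (K × K) := {p | p.1 = k}

/-- The affine points of the curve `D(m,d)`. -/
def curveD (e : ℕ) (ε b m d : K) : Set (K × K) :=
  {p | p.2 = titsTerm e ε p.1 + b * p.1 ^ (2 ^ e + 1) + m * p.1 + d}

/-- The lines of the plane `𝔄'_ε`, whose points are those of `AG(2,K)`: the vertical lines and the
curves `D(m,d)`. -/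
def planeLines (e : ℕ) (ε b : K) : Set (Set (K × K)) :=
  {l | (∃ k, l = verticalLine k) ∨ ∃ m d, l = curveD e ε b m d}

/-- The point at infinity `Y_∞` of the vertical lines in the projective closure of `𝔄'_ε`. -/
def pointY (e : ℕ) (ε b : K) : ClosurePoint (planeLines e ε b) :=
  Sum.inr ⟨parallelClass (planeLines e ε b) (verticalLine 0),
    verticalLine 0, Or.inl ⟨0, rfl⟩, rfl⟩

/-- The affine point `(1, x, y)` of `PG(2,K)`. -/
def affinePoint (x y : K) : PG2 K :=
  Projectivization.mk K ![1, x, y] (fun h => one_ne_zero (congrFun h 0))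

/-- The point `Y_∞ = (0, 0, 1)` of `PG(2,K)`. -/
def pgPointY : PG2 K :=
  Projectivization.mk K ![0, 0, 1] (fun h => one_ne_zero (congrFun h 2))

/-- The point set `{(x, b x^(q+1) + r)} ∪ {Y_∞}` in the projective closure of `𝔄'_ε`, where
`x ∈ GF(q²)`, `r ∈ GF(q) = F`. -/
def setUb (F : Type*) [Field F] [Algebra F K] (e : ℕ) (ε b : K) :
    Set (ClosurePoint (planeLines e ε b)) :=
  {p | (∃ (x : K) (r : F), p = Sum.inl (x, b * x ^ (2 ^ e + 1) + algebraMap F K r)) ∨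
    p = pointY e ε b}

/-- The point set `U_ε = {(1, x, [...]ε + r)} ∪ {Y_∞}` of `PG(2,K)`, where `x ∈ GF(q²)`,
`r ∈ GF(q) = F`. -/
def setUeps (F : Type*) [Field F] [Algebra F K] (e : ℕ) (ε : K) : Set (PG2 K) :=
  {p | (∃ (x : K) (r : F), p = affinePoint x (titsTerm e ε x + algebraMap F K r)) ∨
    p = pgPointY}

end Plane

end Unitals

open Unitals

namespace Unitals

/-! ### The Tits form -/

/-! The trace condition gives `ε ^ q = ε + 1`, so for x = s + tε with s, t in GF(q) one has x^q + x
= t and (x^q + x)ε + x = s. Hence g(x) = f(s, t)ε, where f is `titsForm`, whose graph is the affine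
part of a Tits ovoid.

Isomorphism: the shear (x, y) ↦ (x, y - g(x) - b x^(q+1)) turns the curve D(m, d) into the line y =
mx + d and fixes vertical lines. Parallel classes correspond to slopes, so it extends to the
closures. It sends b x^(q+1) + r to r - g(x) = g(x) + r.

Unital: D(m, d) meets the set where g(x) + mx + d lies in GF(q). Comparing coefficients of ε gives
f(s, t) = αs + βt + γ, a plane section of the ovoid. The group of the ovoid moves it to f = c
(`titsForm_eq_affine_iff`). The fibre over 0 is one point (`titsForm_eq_zero_iff`), and a scaling
permutes the q - 1 other fibres transitively, so each has (q² - 1)/(q - 1) = q + 1 points.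

B-T: adding GF(q) to the last coordinate of (1, x, g(x)) means joining to the vertex (0, 0, 1) of a
cone over the ovoid (`isBTPointSet_setUeps`).

Non-classical: for a Hermitian unital the feet of any point lie on its polar line, and collinearity
of feet survives every isomorphism. Here (1, 0, ε) has three feet that are collinear only if δ = 1
(`not_feetCollinear_setUb`). -/

/-- The form `s^(σ+2) + s t + t^σ` of the Tits ovoid. -/
def titsForm {F : Type*} [Field F] (e : ℕ) (s t : F) : F :=
  s ^ (2 ^ ((e + 1) / 2) + 2) + s * t + t ^ (2 ^ ((e + 1) / 2))

theorem finite_of_card_two_pow {α : Type*} {e : ℕ} (h : Nat.card α = 2 ^ e) : Finite α :=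
  Nat.finite_of_card_ne_zero (by rw [h]; positivity)

section TitsForm

variable {F : Type*} [Field F] {e : ℕ}

theorem charP_two_of_card (hF : Nat.card F = 2 ^ e) : CharP F 2 := by
  have := finite_of_card_two_pow hF
  refine CharTwo.of_one_ne_zero_of_two_eq_zero one_ne_zero ?_
  have h : ((Nat.card F : ℕ) : F) = 0 := by
    have := Fintype.ofFinite F
    rw [Nat.card_eq_fintype_card]; exact Nat.cast_card_eq_zero F
  rw [hF] at h
  push_cast at h
  exact eq_zero_of_pow_eq_zero h

theorem pow_two_pow_eq_self (hF : Nat.card F = 2 ^ e) (x : F) : x ^ (2 ^ e) = x := by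
  have := finite_of_card_two_pow hF
  have := Fintype.ofFinite F
  rw [← hF, Nat.card_eq_fintype_card]
  exact FiniteField.pow_card x

/-- For odd e the exponent (e+1)/2 is exact, so σ² raises to the power 2^(e+1) = 2q, and x^q = x.
Thus σ is a square root of the Frobenius map. -/
theorem tits_automorphism_sq (hodd : Odd e) (hF : Nat.card F = 2 ^ e) (x : F) :
    (x ^ (2 ^ ((e + 1) / 2))) ^ (2 ^ ((e + 1) / 2)) = x ^ 2 := by
  obtain ⟨k, rfl⟩ := hodd
  have h : (2 * k + 1 + 1) / 2 = k + 1 := by omega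
  rw [h, ← pow_mul, ← pow_add, show k + 1 + (k + 1) = (2 * k + 1) + 1 by ring, pow_succ, pow_mul,
    pow_two_pow_eq_self hF]

/-- These are the ovoid automorphisms fixing its point at infinity. The cross term a²s^σ of
(s+a)^(σ+2) cancels against (a^σ s)^σ, and a^σ s² against s · a^σ s, so f changes only by an affine
function. -/
theorem titsForm_shift (hodd : Odd e) (hF : Nat.card F = 2 ^ e) (s t a b : F) :
    titsForm e (s + a) (t + a ^ (2 ^ ((e + 1) / 2)) * s + b) =
      titsForm e s t + (b + a ^ (2 ^ ((e + 1) / 2)) * a) * s + a * t + titsForm e a b := by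
  have := charP_two_of_card hF
  have h2 : (2 : F) = 0 := CharTwo.two_eq_zero
  have hσ := tits_automorphism_sq hodd hF a
  unfold titsForm
  rw [pow_add, pow_add s, pow_add a, add_pow_char_pow, add_pow_char_pow, add_pow_char_pow,
    mul_pow, hσ]
  generalize 2 ^ ((e + 1) / 2) = n
  linear_combination (s ^ n * s * a + s ^ n * a ^ 2 + a ^ n * s ^ 2 + a ^ n * s * a) * h2

/-- The shift with a = β and b = α + β^(σ+1) adds exactly αs + βt and a constant, which turns an
arbitrary section into a fibre of f. -/
theorem titsForm_eq_affine_iff (hodd : Odd e) (hF : Nat.card F = 2 ^ e) (s t α β γ : F) :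
    titsForm e s t = α * s + β * t + γ ↔
      titsForm e (s + β) (t + β ^ (2 ^ ((e + 1) / 2)) * s + (α + β ^ (2 ^ ((e + 1) / 2)) * β)) =
        γ + titsForm e β (α + β ^ (2 ^ ((e + 1) / 2)) * β) := by
  have := charP_two_of_card hF
  have h2 : (2 : F) = 0 := CharTwo.two_eq_zero
  rw [titsForm_shift hodd hF]
  generalize 2 ^ ((e + 1) / 2) = n
  constructor <;> intro h
  · linear_combination h + (α * s + β * t + β ^ n * β * s) * h2
  · linear_combination h - (α * s + β * t + β ^ n * β * s) * h2

theorem titsForm_smul (hodd : Odd e) (hF : Nat.card F = 2 ^ e) (l s t : F) :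
    titsForm e (l * s) (l ^ (2 ^ ((e + 1) / 2) + 1) * t) =
      l ^ (2 ^ ((e + 1) / 2) + 2) * titsForm e s t := by
  have hσ := tits_automorphism_sq hodd hF l
  unfold titsForm
  rw [mul_pow, mul_pow, pow_succ l (2 ^ ((e + 1) / 2)), mul_pow (l ^ _), hσ]
  ring

theorem titsForm_zero_zero : titsForm e (0 : F) 0 = 0 := by
  simp [titsForm]

/-- Scaling reduces to s = 1, where f = 0 reads w^σ = w + 1. Applying σ again gives w² = w, and
neither 0 nor 1 satisfies the equation. -/
theorem titsForm_eq_zero_iff (hodd : Odd e) (hF : Nat.card F = 2 ^ e) (s t : F) :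
    titsForm e s t = 0 ↔ s = 0 ∧ t = 0 := by
  have := charP_two_of_card hF
  have h2 : (2 : F) = 0 := CharTwo.two_eq_zero
  refine ⟨fun h => ?_, by rintro ⟨rfl, rfl⟩; exact titsForm_zero_zero⟩
  by_cases hs : s = 0
  · subst hs
    simpa [titsForm] using h
  exfalso
  have key : ∀ w : F, titsForm e 1 w ≠ 0 := by
    intro w hw
    have h1 : w ^ (2 ^ ((e + 1) / 2)) = w + 1 := by
      unfold titsForm at hw
      rw [one_pow] at hw
      linear_combination hw - (w + 1) * h2
    have h3 := tits_automorphism_sq hodd hF w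
    rw [h1, add_pow_char_pow, h1, one_pow] at h3
    have h4 : w * (w - 1) = 0 := by linear_combination -h3 + h2
    rcases mul_eq_zero.mp h4 with h5 | h5
    · rw [h5] at h1; simp at h1
    · rw [sub_eq_zero.mp h5, one_pow] at h1; simp at h1
  have h3 := titsForm_smul hodd hF s 1 ((s ^ (2 ^ ((e + 1) / 2) + 1))⁻¹ * t)
  rw [mul_one, mul_inv_cancel_left₀ (pow_ne_zero _ hs), h] at h3
  rcases mul_eq_zero.mp h3.symm with h4 | h4
  · exact pow_ne_zero _ hs h4
  · exact key _ h4

/-- On the finite group of units it suffices that u ↦ u^(σ+2) is injective. If u^σ = u^(-2), then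
applying σ gives u² = u^4, so u² = 1 and u = 1. -/
theorem exists_pow_tits_eq (hodd : Odd e) (hF : Nat.card F = 2 ^ e) {c : F} (hc : c ≠ 0) :
    ∃ l : F, l ≠ 0 ∧ l ^ (2 ^ ((e + 1) / 2) + 2) = c := by
  have := charP_two_of_card hF
  have := finite_of_card_two_pow hF
  let f : Fˣ →* Fˣ := powMonoidHom (2 ^ ((e + 1) / 2) + 2)
  have hf : Function.Injective f := by
    rw [injective_iff_map_eq_one]
    intro u hu
    have h1 : (u : F) ^ (2 ^ ((e + 1) / 2)) * (u : F) ^ 2 = 1 := by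
      have := congrArg Units.val hu
      simpa [f, pow_add] using this
    have h3 := congrArg (fun x : F => x ^ (2 ^ ((e + 1) / 2))) h1
    simp only [mul_pow, one_pow] at h3
    rw [tits_automorphism_sq hodd hF, pow_right_comm] at h3
    have h4 : (u : F) ^ 2 = 1 := by
      linear_combination (-(u : F) ^ 2) * h3 +
        ((u : F) ^ (2 ^ ((e + 1) / 2)) * (u : F) ^ 2 + 1) * h1
    have h5 : ((u : F) - 1) ^ 2 = 0 := by
      linear_combination h4 + (1 - (u : F)) * (CharTwo.two_eq_zero : (2 : F) = 0)
    exact Units.ext (sub_eq_zero.mp (eq_zero_of_pow_eq_zero h5))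
  obtain ⟨l, hl⟩ := (Finite.injective_iff_surjective.mp hf) (Units.mk0 c hc)
  exact ⟨l, l.ne_zero, by simpa [f] using congrArg Units.val hl⟩

theorem ncard_titsForm_fiber (he : e ≠ 0) (hodd : Odd e) (hF : Nat.card F = 2 ^ e) {c : F}
    (hc : c ≠ 0) : {p : F × F | titsForm e p.1 p.2 = c}.ncard = 2 ^ e + 1 := by
  classical
  have := finite_of_card_two_pow hF
  have := Fintype.ofFinite F
  rw [Nat.card_eq_fintype_card] at hF
  have hF' : Nat.card F = 2 ^ e := by rw [Nat.card_eq_fintype_card, hF]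
  let N : F → ℕ := fun c => (Finset.univ.filter fun p : F × F => titsForm e p.1 p.2 = c).card
  have hN : ∀ c : F, c ≠ 0 → N c = N 1 := by
    intro c hc
    obtain ⟨l, hl, rfl⟩ := exists_pow_tits_eq hodd hF' hc
    symm
    refine Finset.card_bij (fun p _ => (l * p.1, l ^ (2 ^ ((e + 1) / 2) + 1) * p.2)) ?_ ?_ ?_
    · intro p hp
      simp only [Finset.mem_filter, Finset.mem_univ, true_and] at hp ⊢
      rw [titsForm_smul hodd hF', hp, mul_one]
    · rintro ⟨a, a'⟩ _ ⟨b, b'⟩ _ h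
      simpa [hl] using h
    · rintro ⟨s, t⟩ h
      simp only [Finset.mem_filter, Finset.mem_univ, true_and] at h
      have hl' := pow_ne_zero (2 ^ ((e + 1) / 2) + 1) hl
      refine ⟨(l⁻¹ * s, (l ^ (2 ^ ((e + 1) / 2) + 1))⁻¹ * t), ?_, ?_⟩
      · simp only [Finset.mem_filter, Finset.mem_univ, true_and]
        have h3 := titsForm_smul hodd hF' l (l⁻¹ * s) ((l ^ (2 ^ ((e + 1) / 2) + 1))⁻¹ * t)
        rw [mul_inv_cancel_left₀ hl, mul_inv_cancel_left₀ hl', h] at h3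
        exact (mul_eq_left₀ (pow_ne_zero _ hl)).mp h3.symm
      · simp [mul_inv_cancel_left₀ hl, mul_inv_cancel_left₀ hl']
  have h0 : N 0 = 1 := by
    simp only [N]
    rw [Finset.card_eq_one]
    refine ⟨(0, 0), ?_⟩
    ext ⟨s, t⟩
    simp [titsForm_eq_zero_iff hodd hF']
  have hsum : ∑ c : F, N c = 2 ^ e * 2 ^ e := by
    have h := Finset.card_eq_sum_card_fiberwise (s := (Finset.univ : Finset (F × F)))
      (t := Finset.univ) (f := fun p => titsForm e p.1 p.2)
      (fun _ _ => Finset.mem_coe.mpr (Finset.mem_univ _))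
    rw [← h, Finset.card_univ, Fintype.card_prod, hF]
  rw [← Finset.add_sum_erase _ _ (Finset.mem_univ 0), h0,
    Finset.sum_congr rfl (fun c hc => hN c (Finset.ne_of_mem_erase hc)), Finset.sum_const,
    Finset.card_erase_of_mem (Finset.mem_univ _), Finset.card_univ, hF, smul_eq_mul] at hsum
  have hq : 2 ≤ 2 ^ e := Nat.le_self_pow he 2
  have h1 : N 1 = 2 ^ e + 1 := by
    -- With q = m + 2, the count 1 + (q - 1)N(1) = q² becomes free of truncated subtraction, and q -
    -- 1 = m + 1 can be cancelled.
    obtain ⟨m, hm⟩ := Nat.exists_eq_add_of_le hq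
    rw [hm] at hsum ⊢
    rw [show 2 + m - 1 = m + 1 by omega] at hsum
    have : (m + 1) * N 1 = (m + 1) * (2 + m + 1) := by linarith
    exact Nat.eq_of_mul_eq_mul_left (Nat.succ_pos m) this
  rw [← h1, ← hN c hc, Set.ncard_eq_toFinset_card']
  simp [N]

theorem ncard_titsForm_eq_affine (he : e ≠ 0) (hodd : Odd e) (hF : Nat.card F = 2 ^ e)
    (α β γ : F) :
    {p : F × F | titsForm e p.1 p.2 = α * p.1 + β * p.2 + γ}.ncard = 1 ∨
      {p : F × F | titsForm e p.1 p.2 = α * p.1 + β * p.2 + γ}.ncard = 2 ^ e + 1 := by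
  let n := 2 ^ ((e + 1) / 2)
  let T : F × F → F × F := fun p => (p.1 + β, p.2 + β ^ n * p.1 + (α + β ^ n * β))
  have hT : Function.Injective T := by
    rintro ⟨s, t⟩ ⟨s', t'⟩ h
    simp only [T, Prod.mk.injEq, add_left_inj] at h
    obtain ⟨rfl, h⟩ := h
    simpa using h
  have hT' : Function.Surjective T := by
    rintro ⟨s, t⟩
    refine ⟨(s - β, t - (α + β ^ n * β) - β ^ n * (s - β)), ?_⟩
    simp [T]
  set c := γ + titsForm e β (α + β ^ n * β) with hc
  have h : {p : F × F | titsForm e p.1 p.2 = α * p.1 + β * p.2 + γ} =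
      T ⁻¹' {p : F × F | titsForm e p.1 p.2 = c} := by
    ext p
    exact titsForm_eq_affine_iff hodd hF p.1 p.2 α β γ
  rw [h, Set.ncard_preimage_of_injective_subset_range hT (by simp [hT'.range_eq])]
  by_cases h0 : c = 0
  · left
    rw [h0, Set.ncard_eq_one]
    refine ⟨(0, 0), ?_⟩
    ext ⟨s, t⟩
    simp [titsForm_eq_zero_iff hodd hF]
  · right
    exact ncard_titsForm_fiber he hodd hF h0

/-- The plane section of the Tits ovoid at a point of it by the tangent plane at that point. -/
theorem titsForm_eq_tangent_iff (hodd : Odd e) (hF : Nat.card F = 2 ^ e) (s t s₀ t₀ : F) :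
    titsForm e s t = t₀ * s + s₀ * t + titsForm e s₀ t₀ ↔ s = s₀ ∧ t = t₀ := by
  have := charP_two_of_card hF
  have h2 : (2 : F) = 0 := CharTwo.two_eq_zero
  constructor
  · have h0 : titsForm e s₀ t₀ = t₀ * s₀ + s₀ * t₀ + titsForm e s₀ t₀ := by
      linear_combination (-t₀ * s₀) * h2
    -- Since (s₀, t₀) lies on the section and the shift carries it to (0, 0), the constant of the
    -- resulting fibre is 0, so the section is a single point.
    rw [titsForm_eq_affine_iff hodd hF] at h0 ⊢
    rw [← h0, CharTwo.add_self_eq_zero]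
    have : t₀ + s₀ ^ (2 ^ ((e + 1) / 2)) * s₀ + (t₀ + s₀ ^ (2 ^ ((e + 1) / 2)) * s₀) = 0 :=
      CharTwo.add_self_eq_zero _
    rw [this, titsForm_zero_zero, titsForm_eq_zero_iff hodd hF]
    rintro ⟨h3, h4⟩
    rw [CharTwo.add_eq_zero] at h3
    subst h3
    refine ⟨rfl, ?_⟩
    linear_combination h4 - (s ^ (2 ^ ((e + 1) / 2)) * s + t₀) * h2
  · rintro ⟨rfl, rfl⟩
    linear_combination (-t * s) * h2

end TitsForm

/-! ### Coordinates over the subfield -/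

section Coordinates

variable {F K : Type*} [Field F] [Field K] [Algebra F K] {e : ℕ}

theorem charP_two_extension (hF : Nat.card F = 2 ^ e) : CharP K 2 := by
  have := charP_two_of_card hF
  exact charP_of_injective_algebraMap (algebraMap F K).injective 2

/-- Iterating ε² = ε + δ accumulates the partial sums of the trace of δ. -/
theorem pow_card_eq_add_one (hF : Nat.card F = 2 ^ e) {δ : F} (hTr : absTrace e δ = 1) {ε : K}
    (hεδ : ε ^ 2 + ε + algebraMap F K δ = 0) : ε ^ (2 ^ e) = ε + 1 := by
  have := charP_two_extension (K := K) hF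
  have h2 : (2 : K) = 0 := CharTwo.two_eq_zero
  have h : ∀ k : ℕ, ε ^ (2 ^ k) =
      ε + algebraMap F K (∑ i ∈ Finset.range k, δ ^ (2 ^ i)) := by
    intro k
    induction k with
    | zero => simp
    | succ k ih =>
      have h1 : ε ^ 2 = ε + algebraMap F K δ := by
        linear_combination hεδ - (ε + algebraMap F K δ) * h2
      rw [pow_succ' 2 k, pow_mul, h1, add_pow_char_pow, ih, Finset.sum_range_succ, map_add,
        map_pow, add_assoc]
  rw [h e]
  unfold absTrace at hTr
  rw [hTr, map_one]

theorem coord_injective {ε : K} (hε : ε ∉ Set.range (algebraMap F K)) {s t s' t' : F}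
    (h : algebraMap F K s + algebraMap F K t * ε = algebraMap F K s' + algebraMap F K t' * ε) :
    s = s' ∧ t = t' := by
  have ht : t = t' := by
    by_contra hne
    have h0 : algebraMap F K (t - t') ≠ 0 := by
      simpa [sub_eq_zero] using hne
    refine hε ⟨(s' - s) / (t - t'), ?_⟩
    rw [map_div₀, div_eq_iff h0, map_sub, map_sub]
    linear_combination -h
  subst ht
  exact ⟨(algebraMap F K).injective (add_right_cancel h), rfl⟩

theorem exists_coord (hK : Module.finrank F K = 2) {ε : K}
    (hε : ε ∉ Set.range (algebraMap F K)) (x : K) :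
    ∃ s t : F, x = algebraMap F K s + algebraMap F K t * ε := by
  have hli : LinearIndependent F ![(1 : K), ε] := by
    rw [LinearIndependent.pair_iff]
    intro s t h
    refine coord_injective hε (s' := 0) (t' := 0) ?_
    simpa [Algebra.smul_def] using h
  have := Module.finite_of_finrank_pos (R := F) (M := K) (by omega)
  have hsp := hli.span_eq_top_of_card_eq_finrank' (by simp [hK])
  have hx : x ∈ Submodule.span F (Set.range ![(1 : K), ε]) := by rw [hsp]; trivial
  rw [Matrix.range_cons, Matrix.range_cons, Matrix.range_empty, Set.union_empty,
    Set.singleton_union, Submodule.mem_span_pair] at hx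
  obtain ⟨s, t, h⟩ := hx
  exact ⟨s, t, by rw [← h]; simp [Algebra.smul_def]⟩

theorem coord_mem_range_iff {ε : K} (hε : ε ∉ Set.range (algebraMap F K)) (s t : F) :
    (∃ r : F, algebraMap F K s + algebraMap F K t * ε = algebraMap F K r) ↔ t = 0 := by
  constructor
  · rintro ⟨r, h⟩
    exact (coord_injective hε (s' := r) (t' := 0) (by simpa using h)).2
  · rintro rfl
    exact ⟨s, by simp⟩

theorem conj_coord (hF : Nat.card F = 2 ^ e) {δ : F} (hTr : absTrace e δ = 1) {ε : K}
    (hεδ : ε ^ 2 + ε + algebraMap F K δ = 0) (s t : F) :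
    (algebraMap F K s + algebraMap F K t * ε) ^ (2 ^ e) =
      algebraMap F K s + algebraMap F K t * (ε + 1) := by
  have := charP_two_extension (K := K) hF
  rw [add_pow_char_pow, mul_pow, pow_card_eq_add_one hF hTr hεδ, ← map_pow, ← map_pow,
    pow_two_pow_eq_self hF, pow_two_pow_eq_self hF]

/-- The two inner expressions of `titsTerm` are the coordinate functions t and s; this is the bridge
from the plane to the ovoid. -/
theorem titsTerm_coord (hF : Nat.card F = 2 ^ e) {δ : F} (hTr : absTrace e δ = 1) {ε : K}
    (hεδ : ε ^ 2 + ε + algebraMap F K δ = 0) (s t : F) :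
    titsTerm e ε (algebraMap F K s + algebraMap F K t * ε) =
      algebraMap F K (titsForm e s t) * ε := by
  have := charP_two_extension (K := K) hF
  have h2 : (2 : K) = 0 := CharTwo.two_eq_zero
  unfold titsTerm
  rw [conj_coord hF hTr hεδ]
  have h1 : algebraMap F K s + algebraMap F K t * (ε + 1) +
      (algebraMap F K s + algebraMap F K t * ε) = algebraMap F K t := by
    linear_combination (algebraMap F K s + algebraMap F K t * ε) * h2
  have h3 : algebraMap F K t * ε + (algebraMap F K s + algebraMap F K t * ε) =
      algebraMap F K s := by
    linear_combination (algebraMap F K t * ε) * h2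
  rw [h1, h3, titsForm]
  simp only [map_add, map_mul, map_pow]
  ring

/-- The points of `U_ε` on the line `y = m x + d`, in coordinates. -/
theorem titsTerm_add_mem_range_iff (hF : Nat.card F = 2 ^ e) {δ : F} (hTr : absTrace e δ = 1)
    {ε : K} (hε : ε ∉ Set.range (algebraMap F K)) (hεδ : ε ^ 2 + ε + algebraMap F K δ = 0)
    (m₀ m₁ d₀ d₁ s t : F) :
    (∃ r : F, titsTerm e ε (algebraMap F K s + algebraMap F K t * ε) +
      (algebraMap F K m₀ + algebraMap F K m₁ * ε) *
        (algebraMap F K s + algebraMap F K t * ε) +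
      (algebraMap F K d₀ + algebraMap F K d₁ * ε) = algebraMap F K r) ↔
    titsForm e s t = m₁ * s + (m₀ + m₁) * t + d₁ := by
  have := charP_two_extension (K := K) hF
  have := charP_two_of_card hF
  have h2 : (2 : K) = 0 := CharTwo.two_eq_zero
  -- Using ε² = ε + δ, the GF(q)-part of mx + d is m₀s + m₁tδ + d₀, and its coefficient of ε is m₁s
  -- + (m₀ + m₁)t + d₁.
  rw [titsTerm_coord hF hTr hεδ, ← CharTwo.add_eq_zero,
    ← coord_mem_range_iff hε (m₀ * s + m₁ * t * δ + d₀)]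
  refine exists_congr fun r => ?_
  rw [← sub_eq_zero, ← sub_eq_zero (b := algebraMap F K r)]
  apply Eq.congr_left
  simp only [map_add, map_mul]
  linear_combination (algebraMap F K m₁ * algebraMap F K t) * hεδ -
    (algebraMap F K m₁ * algebraMap F K t * (algebraMap F K δ + ε)) * h2

end Coordinates

/-! ### Parallel classes -/

theorem mem_verticalLine_iff {K : Type*} {k x y : K} : (x, y) ∈ verticalLine k ↔ x = k :=
  Iff.rfl

section ParallelClasses

variable {K : Type*} [Field K] {e : ℕ} {ε b : K}

theorem verticalLine_mem_planeLines (k : K) : verticalLine k ∈ planeLines e ε b :=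
  Or.inl ⟨k, rfl⟩

theorem curveD_mem_planeLines (m d : K) : curveD e ε b m d ∈ planeLines e ε b :=
  Or.inr ⟨m, d, rfl⟩

theorem mem_curveD_iff {m d x y : K} : (x, y) ∈ curveD e ε b m d ↔
    y = titsTerm e ε x + b * x ^ (2 ^ e + 1) + m * x + d :=
  Iff.rfl

theorem not_disjoint_verticalLine_curveD (k m d : K) :
    ¬ Disjoint (verticalLine k) (curveD e ε b m d) :=
  Set.not_disjoint_iff.mpr
    ⟨(k, titsTerm e ε k + b * k ^ (2 ^ e + 1) + m * k + d), rfl, rfl⟩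

theorem curveD_ne_verticalLine (k m d : K) : curveD e ε b m d ≠ verticalLine k := by
  intro h
  have h1 : (k + 1, titsTerm e ε (k + 1) + b * (k + 1) ^ (2 ^ e + 1) + m * (k + 1) + d) ∈
      curveD e ε b m d := rfl
  rw [h, mem_verticalLine_iff] at h1
  simp at h1

theorem eq_of_curveD_subset {m d m' d' : K} (h : curveD e ε b m d = curveD e ε b m' d') :
    m = m' ∧ d = d' := by
  have h1 : ∀ x : K, m * x + d = m' * x + d' := by
    intro x
    have h1 : (x, titsTerm e ε x + b * x ^ (2 ^ e + 1) + m * x + d) ∈ curveD e ε b m d := rfl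
    rw [h, mem_curveD_iff] at h1
    linear_combination h1
  have h0 : d = d' := by simpa using h1 0
  subst h0
  exact ⟨by simpa using h1 1, rfl⟩

theorem parallelClass_verticalLine (k : K) :
    parallelClass (planeLines e ε b) (verticalLine k) = Set.range verticalLine := by
  ext l
  constructor
  · rintro ⟨⟨k', rfl⟩ | ⟨m, d, rfl⟩, h⟩
    · exact ⟨k', rfl⟩
    · rcases h with h | h
      · exact absurd h (curveD_ne_verticalLine _ _ _)
      · exact absurd h.symm (not_disjoint_verticalLine_curveD _ _ _)
  · rintro ⟨k', rfl⟩
    refine ⟨verticalLine_mem_planeLines k', ?_⟩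
    by_cases h : k' = k
    · exact Or.inl (by rw [h])
    · right
      rw [Set.disjoint_left]
      rintro ⟨x, y⟩ h1 h2
      exact h (h1.symm.trans h2)

theorem parallelClass_curveD (m d : K) :
    parallelClass (planeLines e ε b) (curveD e ε b m d) = Set.range (curveD e ε b m) := by
  ext l
  constructor
  · rintro ⟨⟨k', rfl⟩ | ⟨m', d', rfl⟩, h⟩
    · rcases h with h | h
      · exact absurd h.symm (curveD_ne_verticalLine _ _ _)
      · exact absurd h (not_disjoint_verticalLine_curveD _ _ _)
    · rcases h with h | h
      · exact ⟨d', by rw [(eq_of_curveD_subset h).1]⟩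
      · by_cases hm : m' = m
        · exact ⟨d', by rw [hm]⟩
        · exfalso
          rw [← sub_eq_zero] at hm
          -- Curves of different slopes share g(x) + b x^(q+1), so they meet over the same x as the
          -- lines with these slopes and intercepts.
          set x := (d - d') / (m' - m)
          have hx : (x, titsTerm e ε x + b * x ^ (2 ^ e + 1) + m' * x + d') ∈
              curveD e ε b m' d' := rfl
          refine Set.disjoint_left.mp h hx ?_
          rw [mem_curveD_iff]
          have : (m' - m) * x = d - d' := mul_div_cancel₀ _ hm
          linear_combination this
  · rintro ⟨d', rfl⟩
    refine ⟨curveD_mem_planeLines m d', ?_⟩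
    by_cases h : d' = d
    · exact Or.inl (by rw [h])
    · right
      rw [Set.disjoint_left]
      rintro ⟨x, y⟩ h1 h2
      rw [mem_curveD_iff] at h1 h2
      exact h (by linear_combination h2 - h1)

variable (e ε b) in
/-- The line of given slope through the origin, `none` being the vertical direction. -/
def slopeLine : Option K → Set (K × K)
  | none => verticalLine 0
  | some m => curveD e ε b m 0

theorem slopeLine_mem_planeLines (o : Option K) : slopeLine e ε b o ∈ planeLines e ε b := by
  cases o with
  | none => exact verticalLine_mem_planeLines 0
  | some m => exact curveD_mem_planeLines m 0

variable (e ε b) in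
/-- The parallel class of given slope. -/
def slopeClass (o : Option K) :
    {c : Set (Set (K × K)) // ∃ l ∈ planeLines e ε b, c = parallelClass (planeLines e ε b) l} :=
  ⟨parallelClass (planeLines e ε b) (slopeLine e ε b o), _, slopeLine_mem_planeLines o, rfl⟩

theorem verticalLine_mem_slopeClass (k : K) (o : Option K) :
    verticalLine k ∈ (slopeClass e ε b o).1 ↔ o = none := by
  cases o with
  | none => simp [slopeClass, slopeLine, parallelClass_verticalLine]
  | some m => simp [slopeClass, slopeLine, parallelClass_curveD, curveD_ne_verticalLine]

theorem curveD_mem_slopeClass (m d : K) (o : Option K) :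
    curveD e ε b m d ∈ (slopeClass e ε b o).1 ↔ o = some m := by
  cases o with
  | none =>
    simp [slopeClass, slopeLine, parallelClass_verticalLine, (curveD_ne_verticalLine _ _ _).symm]
  | some m' =>
    simp only [slopeClass, slopeLine, parallelClass_curveD, Set.mem_range, Option.some.injEq]
    exact ⟨fun ⟨d', h⟩ => (eq_of_curveD_subset h).1, fun h => ⟨d, by rw [h]⟩⟩

/-- Replaces the abstract points at infinity by slopes, so that they can be matched with the points
of `PG2 K` on the line [1, 0, 0]. -/
theorem slopeClass_bijective : Function.Bijective (slopeClass e ε b) := by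
  constructor
  · intro o o' h
    cases o with
    | none => exact ((verticalLine_mem_slopeClass 0 o').mp
        (h ▸ (verticalLine_mem_slopeClass 0 none).mpr rfl)).symm
    | some m => exact ((curveD_mem_slopeClass m 0 o').mp
        (h ▸ (curveD_mem_slopeClass m 0 (some m)).mpr rfl)).symm
  · rintro ⟨_, l, ⟨k, rfl⟩ | ⟨m, d, rfl⟩, rfl⟩
    · exact ⟨none, Subtype.ext (by
        simp [slopeClass, slopeLine, parallelClass_verticalLine])⟩
    · exact ⟨some m, Subtype.ext (by
        simp [slopeClass, slopeLine, parallelClass_curveD])⟩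

theorem pointY_eq : pointY e ε b = Sum.inr (slopeClass e ε b none) :=
  rfl

end ParallelClasses

/-! ### Points and lines of `PG(2,K)` in coordinates -/

section PG

variable {K : Type*} [Field K]

/-- The line of `PG(2,K)` with the homogeneous coordinates `c`. -/
def pgLine (c : Fin 3 → K) : Set (PG2 K) :=
  {p | c 0 * p.rep 0 + c 1 * p.rep 1 + c 2 * p.rep 2 = 0}

theorem mk_mem_pgLine_iff (c w : Fin 3 → K) (hw : w ≠ 0) :
    (Projectivization.mk K w hw : PG2 K) ∈ pgLine c ↔ c 0 * w 0 + c 1 * w 1 + c 2 * w 2 = 0 := by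
  obtain ⟨a, ha⟩ := Projectivization.exists_smul_eq_mk_rep K w hw
  simp only [pgLine, Set.mem_ofPred_eq, ← ha, Pi.smul_apply, Units.smul_def, smul_eq_mul]
  rw [← mul_eq_zero_iff_left a.ne_zero (b := c 0 * w 0 + c 1 * w 1 + c 2 * w 2)]
  constructor <;> intro h <;> linear_combination h

theorem submodule_le_iff_rep_mem {F V : Type*} [Field F] [AddCommGroup V] [Module F V]
    (p : ℙ F V) (W : Submodule F V) : p.submodule ≤ W ↔ p.rep ∈ W := by
  rw [Projectivization.submodule_eq, Submodule.span_singleton_le_iff_mem]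

theorem mem_pgLines_iff (s : Set (PG2 K)) : s ∈ pgLines K ↔ ∃ c ≠ 0, s = pgLine c := by
  constructor
  · rintro ⟨W, hW, rfl⟩
    have hlt : W < ⊤ := by
      rw [lt_top_iff_ne_top]
      rintro rfl
      rw [finrank_top, Module.finrank_fin_fun] at hW
      omega
    obtain ⟨f, hf, hWf⟩ := Submodule.exists_le_ker_of_lt_top W hlt
    have hk := Module.Dual.finrank_ker_add_one_of_ne_zero hf
    rw [Module.finrank_fin_fun] at hk
    have hWe : W = LinearMap.ker f := Submodule.eq_of_le_of_finrank_eq hWf (by omega)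
    have hfe : ∀ w : Fin 3 → K, f w = f (Pi.single 0 1) * w 0 + f (Pi.single 1 1) * w 1 +
        f (Pi.single 2 1) * w 2 := by
      intro w
      rw [LinearMap.pi_apply_eq_sum_univ f w, Fin.sum_univ_three]
      have : ∀ i : Fin 3, (fun j => if i = j then (1 : K) else 0) = Pi.single i 1 := by
        intro i; ext j; simp [Pi.single_apply, eq_comm]
      simp only [this, smul_eq_mul]
      ring
    refine ⟨fun i => f (Pi.single i 1), ?_, ?_⟩
    · intro h
      apply hf
      ext i
      simpa using congrFun h i
    · ext p
      rw [Set.mem_ofPred_eq, submodule_le_iff_rep_mem, hWe, LinearMap.mem_ker, hfe]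
      rfl
  · rintro ⟨c, hc, rfl⟩
    let f : Module.Dual K (Fin 3 → K) := ∑ i, c i • LinearMap.proj i
    have hf : f ≠ 0 := by
      intro h
      apply hc
      ext i
      simpa [f, Pi.single_apply] using LinearMap.congr_fun h (Pi.single i 1)
    have hk := Module.Dual.finrank_ker_add_one_of_ne_zero hf
    rw [Module.finrank_fin_fun] at hk
    refine ⟨LinearMap.ker f, by omega, ?_⟩
    ext p
    rw [Set.mem_ofPred_eq, submodule_le_iff_rep_mem, LinearMap.mem_ker]
    simp [f, pgLine, Fin.sum_univ_three]

theorem pgLine_smul {a : K} (ha : a ≠ 0) (c : Fin 3 → K) : pgLine (a • c) = pgLine c := by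
  ext p
  simp only [pgLine, Set.mem_ofPred_eq, Pi.smul_apply, smul_eq_mul]
  rw [← mul_eq_zero_iff_left ha (b := c 0 * p.rep 0 + c 1 * p.rep 1 + c 2 * p.rep 2)]
  constructor <;> intro h <;> linear_combination h

/-- The point at infinity of `PG(2,K)` of given slope. -/
def pgInfinity : Option K → PG2 K
  | none => pgPointY
  | some m => Projectivization.mk K ![0, 1, m] (fun h => one_ne_zero (congrFun h 1))

variable (K) in
/-- The points of `PG(2,K)` as affine points and points at infinity. -/
def pgOfSum : (K × K) ⊕ Option K → PG2 K :=
  Sum.elim (fun p => affinePoint p.1 p.2) pgInfinity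

theorem pgOfSum_bijective : Function.Bijective (pgOfSum K) := by
  constructor
  · rintro (⟨x, y⟩ | _ | m) (⟨x', y'⟩ | _ | m') h
    -- The fifth of the nine cases compares the vertical direction with itself.
    on_goal 5 => rfl
    all_goals
      simp only [pgOfSum, pgInfinity, Sum.elim_inl, Sum.elim_inr, affinePoint, pgPointY,
        Projectivization.mk_eq_mk_iff'] at h
      obtain ⟨a, ha⟩ := h
      have h0 := congrFun ha 0
      have h1 := congrFun ha 1
      have h2 := congrFun ha 2
      simp at h0 h1 h2
    all_goals simp_all
  · intro p
    induction p using Projectivization.ind with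
    | h w hw =>
      by_cases h0 : w 0 = 0
      · by_cases h1 : w 1 = 0
        · refine ⟨Sum.inr none, ?_⟩
          have h2 : w 2 ≠ 0 := by
            intro h2
            apply hw
            ext i
            fin_cases i <;> assumption
          simp only [pgOfSum, pgInfinity, Sum.elim_inr, pgPointY,
            Projectivization.mk_eq_mk_iff']
          refine ⟨(w 2)⁻¹, ?_⟩
          ext i
          fin_cases i <;> simp [h0, h1, h2]
        · refine ⟨Sum.inr (some (w 2 / w 1)), ?_⟩
          simp only [pgOfSum, pgInfinity, Sum.elim_inr, Projectivization.mk_eq_mk_iff']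
          refine ⟨(w 1)⁻¹, ?_⟩
          ext i
          fin_cases i <;> simp [h0, h1, div_eq_inv_mul]
      · refine ⟨Sum.inl (w 1 / w 0, w 2 / w 0), ?_⟩
        simp only [pgOfSum, Sum.elim_inl, affinePoint, Projectivization.mk_eq_mk_iff']
        refine ⟨(w 0)⁻¹, ?_⟩
        ext i
        fin_cases i <;> simp [h0, div_eq_inv_mul]

end PG

/-! ### The isomorphism onto `PG(2,K)` -/

section Isomorphism

variable {K : Type*} [Field K] (e : ℕ) (ε b : K)

/-- The affine part `(ξ, η + g(ξ) + b ξ^(q+1)) ↦ (ξ, η)` of the isomorphism. -/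
def shearEquiv : K × K ≃ K × K where
  toFun p := (p.1, p.2 - (titsTerm e ε p.1 + b * p.1 ^ (2 ^ e + 1)))
  invFun p := (p.1, p.2 + (titsTerm e ε p.1 + b * p.1 ^ (2 ^ e + 1)))
  left_inv p := by simp
  right_inv p := by simp

/-- The isomorphism from the projective closure onto `PG(2,K)`. -/
noncomputable def closureEquiv : ClosurePoint (planeLines e ε b) ≃ PG2 K :=
  ((shearEquiv e ε b).sumCongr (Equiv.ofBijective _ slopeClass_bijective).symm).trans
    (Equiv.ofBijective _ pgOfSum_bijective)

theorem closureEquiv_inl (x y : K) : closureEquiv e ε b (Sum.inl (x, y)) =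
    affinePoint x (y - (titsTerm e ε x + b * x ^ (2 ^ e + 1))) :=
  rfl

theorem closureEquiv_slopeClass (o : Option K) :
    closureEquiv e ε b (Sum.inr (slopeClass e ε b o)) = pgInfinity o := by
  have : (Equiv.ofBijective _ (slopeClass_bijective (e := e) (ε := ε) (b := b))).symm
      (slopeClass e ε b o) = o :=
    (Equiv.symm_apply_eq _).mpr rfl
  simp only [closureEquiv, Equiv.trans_apply, Equiv.sumCongr_apply, Sum.map_inr, this]
  rfl

variable {e ε b}

theorem inl_mem_extendLine {P : Type*} {lines : Set (Set P)} {l : Set P} {a : P} :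
    (Sum.inl a : ClosurePoint lines) ∈ extendLine lines l ↔ a ∈ l := by
  simp [extendLine]

theorem inr_mem_extendLine {P : Type*} {lines : Set (Set P)} {l : Set P}
    {c : {c : Set (Set P) // ∃ l ∈ lines, c = parallelClass lines l}} :
    (Sum.inr c : ClosurePoint lines) ∈ extendLine lines l ↔ l ∈ c.1 := by
  constructor
  · rintro (⟨a, _, h⟩ | ⟨c', h, h'⟩)
    · cases h
    · cases h'; exact h
  · exact fun h => Or.inr ⟨c, h, rfl⟩

theorem closurePoint_ext {s t : Set (ClosurePoint (planeLines e ε b))}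
    (haff : ∀ x y, Sum.inl (x, y) ∈ s ↔ Sum.inl (x, y) ∈ t)
    (hinf : ∀ o, Sum.inr (slopeClass e ε b o) ∈ s ↔ Sum.inr (slopeClass e ε b o) ∈ t) :
    s = t := by
  ext (⟨x, y⟩ | c)
  · exact haff x y
  · obtain ⟨o, rfl⟩ := slopeClass_bijective.2 c
    exact hinf o

theorem extendLine_verticalLine (k : K) : extendLine (planeLines e ε b) (verticalLine k) =
    closureEquiv e ε b ⁻¹' pgLine ![k, -1, 0] := by
  refine closurePoint_ext (fun x y => ?_) (fun o => ?_)
  · rw [inl_mem_extendLine, Set.mem_preimage, closureEquiv_inl, affinePoint, mk_mem_pgLine_iff,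
      mem_verticalLine_iff]
    simp [← sub_eq_add_neg, sub_eq_zero, eq_comm]
  · rw [inr_mem_extendLine, Set.mem_preimage, closureEquiv_slopeClass,
      verticalLine_mem_slopeClass]
    cases o with
    | none => simp [pgInfinity, pgPointY, mk_mem_pgLine_iff]
    | some m => simp [pgInfinity, mk_mem_pgLine_iff]

theorem extendLine_curveD (m d : K) :
    extendLine (planeLines e ε b) (curveD e ε b m d) =
      closureEquiv e ε b ⁻¹' pgLine ![d, m, -1] := by
  refine closurePoint_ext (fun x y => ?_) (fun o => ?_)
  · rw [inl_mem_extendLine, Set.mem_preimage, closureEquiv_inl, affinePoint, mk_mem_pgLine_iff,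
      mem_curveD_iff]
    simp only [Matrix.cons_val]
    constructor <;> intro h <;> linear_combination -h
  · rw [inr_mem_extendLine, Set.mem_preimage, closureEquiv_slopeClass, curveD_mem_slopeClass]
    cases o with
    | none => simp [pgInfinity, pgPointY, mk_mem_pgLine_iff]
    | some m' =>
      simp [pgInfinity, mk_mem_pgLine_iff, ← sub_eq_add_neg, sub_eq_zero, eq_comm]

theorem range_inr_eq : Set.range Sum.inr = closureEquiv e ε b ⁻¹' pgLine ![1, 0, 0] := by
  refine closurePoint_ext (fun x y => ?_) (fun o => ?_)
  · rw [Set.mem_preimage, closureEquiv_inl, affinePoint, mk_mem_pgLine_iff]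
    simp
  · rw [Set.mem_preimage, closureEquiv_slopeClass]
    cases o with
    | none => simp [pgInfinity, pgPointY, mk_mem_pgLine_iff]
    | some m => simp [pgInfinity, mk_mem_pgLine_iff]

theorem closureEquiv_isIsomorphism :
    IsIsomorphism (closureLines (planeLines e ε b)) (pgLines K) (closureEquiv e ε b) := by
  intro s
  rw [mem_pgLines_iff]
  constructor
  · rintro (⟨_, ⟨k, rfl⟩ | ⟨m, d, rfl⟩, rfl⟩ | rfl)
    · rw [extendLine_verticalLine, Equiv.image_preimage]
      exact ⟨_, fun h => by simpa using congrFun h 1, rfl⟩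
    · rw [extendLine_curveD, Equiv.image_preimage]
      exact ⟨_, fun h => by simpa using congrFun h 2, rfl⟩
    · rw [range_inr_eq, Equiv.image_preimage]
      exact ⟨_, fun h => by simpa using congrFun h 0, rfl⟩
  · rintro ⟨c, hc, h⟩
    have hs : s = closureEquiv e ε b ⁻¹' pgLine c := by
      rw [← h, Equiv.preimage_image]
    rw [hs]
    -- Up to a scalar, a nonzero coordinate triple is [d, m, -1], [k, -1, 0] or [1, 0, 0], and these
    -- are the three kinds of closure lines.
    by_cases h2 : c 2 = 0
    · by_cases h1 : c 1 = 0
      · right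
        have h0 : c 0 ≠ 0 := by
          intro h0
          apply hc
          ext i
          fin_cases i <;> assumption
        rw [range_inr_eq, ← pgLine_smul (inv_ne_zero h0)]
        congr 2
        ext i
        fin_cases i <;> simp [h0, h1, h2]
      · left
        refine ⟨_, verticalLine_mem_planeLines (-(c 0 / c 1)), ?_⟩
        rw [extendLine_verticalLine, ← pgLine_smul (neg_ne_zero.mpr (inv_ne_zero h1))]
        congr 2
        ext i
        fin_cases i <;> simp [h1, h2, div_eq_inv_mul]
    · left
      refine ⟨_, curveD_mem_planeLines (-(c 1 / c 2)) (-(c 0 / c 2)), ?_⟩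
      rw [extendLine_curveD, ← pgLine_smul (neg_ne_zero.mpr (inv_ne_zero h2))]
      congr 2
      ext i
      fin_cases i <;> simp [h2, div_eq_inv_mul]

theorem closureEquiv_apply_affine (ξ η : K) :
    closureEquiv e ε b (Sum.inl (ξ, η + titsTerm e ε ξ + b * ξ ^ (2 ^ e + 1))) =
      affinePoint ξ η := by
  rw [closureEquiv_inl]
  congr 1
  ring

theorem closureEquiv_pointY : closureEquiv e ε b (pointY e ε b) = pgPointY :=
  closureEquiv_slopeClass e ε b none

theorem closureEquiv_image_setUb [CharP K 2] {F : Type*} [Field F] [Algebra F K] :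
    closureEquiv e ε b '' setUb F e ε b = setUeps F e ε := by
  have key : ∀ (x : K) (r : F),
      closureEquiv e ε b (Sum.inl (x, b * x ^ (2 ^ e + 1) + algebraMap F K r)) =
        affinePoint x (titsTerm e ε x + algebraMap F K r) := by
    intro x r
    rw [closureEquiv_inl]
    congr 1
    linear_combination (-titsTerm e ε x) * (CharTwo.two_eq_zero : (2 : K) = 0)
  ext p
  constructor
  · rintro ⟨_, ⟨x, r, rfl⟩ | rfl, rfl⟩
    · exact Or.inl ⟨x, r, key x r⟩
    · exact Or.inr closureEquiv_pointY
  · rintro (⟨x, r, rfl⟩ | rfl)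
    · exact ⟨_, Or.inl ⟨x, r, rfl⟩, key x r⟩
    · exact ⟨_, Or.inr rfl, closureEquiv_pointY⟩

end Isomorphism

/-! ### The unital property -/

section Unital

variable {F K : Type*} [Field F] [Field K] [Algebra F K] {e : ℕ} {ε b : K}

theorem natCard_extension (hF : Nat.card F = 2 ^ e) (hK : Module.finrank F K = 2) :
    Nat.card K = 2 ^ e * 2 ^ e := by
  have := finite_of_card_two_pow hF
  have := Module.finite_of_finrank_pos (R := F) (M := K) (by omega)
  rw [Module.natCard_eq_pow_finrank (K := F), hF, hK, sq]

theorem setUb_eq_range : setUb F e ε b = Set.range (fun o : Option (K × F) =>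
    o.elim (pointY e ε b)
      fun p => Sum.inl (p.1, b * p.1 ^ (2 ^ e + 1) + algebraMap F K p.2)) := by
  ext p
  constructor
  · rintro (⟨x, r, rfl⟩ | rfl)
    · exact ⟨some (x, r), rfl⟩
    · exact ⟨none, rfl⟩
  · rintro ⟨_ | ⟨x, r⟩, rfl⟩
    · exact Or.inr rfl
    · exact Or.inl ⟨x, r, rfl⟩

theorem inl_mem_setUb_iff {x y : K} : Sum.inl (x, y) ∈ setUb F e ε b ↔
    ∃ r : F, y = b * x ^ (2 ^ e + 1) + algebraMap F K r := by
  constructor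
  · rintro (⟨x', r, h⟩ | h)
    · simp only [Sum.inl.injEq, Prod.mk.injEq] at h
      obtain ⟨rfl, rfl⟩ := h
      exact ⟨r, rfl⟩
    · cases h
  · rintro ⟨r, rfl⟩
    exact Or.inl ⟨x, r, rfl⟩

theorem inr_mem_setUb_iff {o : Option K} :
    Sum.inr (slopeClass e ε b o) ∈ setUb F e ε b ↔ o = none := by
  constructor
  · rintro (⟨x', r, h⟩ | h)
    · cases h
    · rw [pointY_eq, Sum.inr.injEq] at h
      exact slopeClass_bijective.1 h
  · rintro rfl
    exact Or.inr rfl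

theorem ncard_range_option {α β : Type*} [Finite α] {f : Option α → β}
    (hf : Function.Injective f) : (Set.range f).ncard = Nat.card α + 1 := by
  rw [← Set.image_univ, Set.ncard_image_of_injective _ hf, Set.ncard_univ, Finite.card_option]

theorem ncard_setUb (hF : Nat.card F = 2 ^ e) (hK : Module.finrank F K = 2) :
    (setUb F e ε b).ncard = (2 ^ e) ^ 3 + 1 := by
  have := finite_of_card_two_pow hF
  have := Module.finite_of_finrank_pos (R := F) (M := K) (by omega)
  have : Finite K := Module.finite_of_finite F
  rw [setUb_eq_range, ncard_range_option, Nat.card_prod, natCard_extension hF hK, hF]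
  · ring
  · rintro (_ | ⟨x, r⟩) (_ | ⟨x', r'⟩) h
    · rfl
    · cases h
    · cases h
    · simp only [Option.elim_some, Sum.inl.injEq, Prod.mk.injEq] at h
      obtain ⟨rfl, h⟩ := h
      rw [(algebraMap F K).injective (add_left_cancel h)]

theorem range_inr_inter_setUb :
    (Set.range Sum.inr ∩ setUb F e ε b : Set (ClosurePoint (planeLines e ε b))) =
      {pointY e ε b} := by
  refine closurePoint_ext (fun x y => ?_) (fun o => ?_)
  · simp [pointY_eq]
  · rw [Set.mem_inter_iff, inr_mem_setUb_iff, Set.mem_singleton_iff, pointY_eq, Sum.inr.injEq,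
      slopeClass_bijective.1.eq_iff]
    simp

theorem extendLine_verticalLine_inter_setUb (k : K) :
    extendLine (planeLines e ε b) (verticalLine k) ∩ setUb F e ε b =
      Set.range (fun o : Option F => o.elim (pointY e ε b)
        fun r => Sum.inl (k, b * k ^ (2 ^ e + 1) + algebraMap F K r)) := by
  refine closurePoint_ext (fun x y => ?_) (fun o => ?_)
  · rw [Set.mem_inter_iff, inl_mem_extendLine, mem_verticalLine_iff, inl_mem_setUb_iff]
    constructor
    · rintro ⟨rfl, r, rfl⟩
      exact ⟨some r, rfl⟩
    · rintro ⟨_ | r, h⟩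
      · cases h
      · simp only [Option.elim_some, Sum.inl.injEq, Prod.mk.injEq] at h
        obtain ⟨rfl, rfl⟩ := h
        exact ⟨rfl, r, rfl⟩
  · rw [Set.mem_inter_iff, inr_mem_setUb_iff, inr_mem_extendLine, verticalLine_mem_slopeClass]
    constructor
    · rintro ⟨rfl, -⟩
      exact ⟨none, rfl⟩
    · rintro ⟨_ | r, h⟩
      · have h' : none = o := slopeClass_bijective.1 (Sum.inr_injective h)
        exact ⟨h'.symm, h'.symm⟩
      · cases h

/-- The term b x^(q+1) occurs both in the curve and in the point set and cancels, so intersection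
sizes do not depend on b. -/
theorem extendLine_curveD_inter_setUb [CharP K 2] (m d : K) :
    extendLine (planeLines e ε b) (curveD e ε b m d) ∩ setUb F e ε b =
      (fun x => Sum.inl (x, titsTerm e ε x + b * x ^ (2 ^ e + 1) + m * x + d)) ''
        {x | ∃ r : F, titsTerm e ε x + m * x + d = algebraMap F K r} := by
  refine closurePoint_ext (fun x y => ?_) (fun o => ?_)
  · rw [Set.mem_inter_iff, inl_mem_extendLine, mem_curveD_iff, inl_mem_setUb_iff]
    constructor
    · rintro ⟨rfl, r, h⟩
      exact ⟨x, ⟨r, by linear_combination h⟩, rfl⟩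
    · rintro ⟨x', ⟨r, hr⟩, h⟩
      simp only [Sum.inl.injEq, Prod.mk.injEq] at h
      obtain ⟨rfl, rfl⟩ := h
      exact ⟨rfl, r, by linear_combination hr⟩
  · rw [Set.mem_inter_iff, inr_mem_setUb_iff, inr_mem_extendLine, curveD_mem_slopeClass]
    constructor
    · rintro ⟨rfl, h⟩
      cases h
    · rintro ⟨_, _, h⟩
      cases h

/-- Coordinates of `GF(q²)` over `GF(q)` with respect to the basis `1, ε`. -/
noncomputable def coordEquiv (hK : Module.finrank F K = 2)
    (hε : ε ∉ Set.range (algebraMap F K)) : F × F ≃ K :=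
  Equiv.ofBijective (fun p => algebraMap F K p.1 + algebraMap F K p.2 * ε)
    ⟨fun _ _ h => Prod.ext (coord_injective hε h).1 (coord_injective hε h).2, fun x => by
      obtain ⟨s, t, h⟩ := exists_coord hK hε x
      exact ⟨(s, t), h.symm⟩⟩

theorem isUnital_setUb (he : e ≠ 0) (hodd : Odd e) (hF : Nat.card F = 2 ^ e)
    (hK : Module.finrank F K = 2) {δ : F} (hTr : absTrace e δ = 1)
    (hε : ε ∉ Set.range (algebraMap F K)) (hεδ : ε ^ 2 + ε + algebraMap F K δ = 0) :
    IsUnital (2 ^ e) (closureLines (planeLines e ε b)) (setUb F e ε b) := by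
  have := charP_two_extension (K := K) hF
  have := finite_of_card_two_pow hF
  refine ⟨ncard_setUb hF hK, ?_⟩
  rintro _ (⟨_, ⟨k, rfl⟩ | ⟨m, d, rfl⟩, rfl⟩ | rfl)
  · right
    rw [extendLine_verticalLine_inter_setUb, ncard_range_option, hF]
    rintro (_ | r) (_ | r') h
    · rfl
    · cases h
    · cases h
    · simp only [Option.elim_some, Sum.inl.injEq, Prod.mk.injEq, true_and] at h
      rw [(algebraMap F K).injective (add_left_cancel h)]
  · rw [extendLine_curveD_inter_setUb, Set.ncard_image_of_injective _
      (fun x x' h => (Prod.ext_iff.mp (Sum.inl_injective h)).1)]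
    obtain ⟨m₀, m₁, rfl⟩ := exists_coord hK hε m
    obtain ⟨d₀, d₁, rfl⟩ := exists_coord hK hε d
    rw [← Set.ncard_preimage_of_injective_subset_range (coordEquiv hK hε).injective
      (by simp [(coordEquiv hK hε).surjective.range_eq])]
    have h := ncard_titsForm_eq_affine he hodd hF m₁ (m₀ + m₁) d₁
    have hset : {p : F × F | titsForm e p.1 p.2 = m₁ * p.1 + (m₀ + m₁) * p.2 + d₁} =
        coordEquiv hK hε ⁻¹' {x | ∃ r : F, titsTerm e ε x +
          (algebraMap F K m₀ + algebraMap F K m₁ * ε) * x +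
          (algebraMap F K d₀ + algebraMap F K d₁ * ε) = algebraMap F K r} := by
      ext p
      exact (titsTerm_add_mem_range_iff hF hTr hε hεδ m₀ m₁ d₀ d₁ p.1 p.2).symm
    rwa [hset] at h
  · left
    rw [range_inr_inter_setUb, Set.ncard_singleton]

end Unital

/-! ### Feet of a point -/

section Feet

/-- `u` is a foot of `x`: a line through `x` meets `U` exactly in `u ≠ x`. -/
def IsFoot {P : Type*} (lines : Set (Set P)) (U : Set P) (x u : P) : Prop :=
  ∃ l ∈ lines, x ∈ l ∧ l ∩ U = {u} ∧ x ≠ u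

/-- The feet of each point are collinear. -/
def FeetCollinear {P : Type*} (lines : Set (Set P)) (U : Set P) : Prop :=
  ∀ x, ∃ m ∈ lines, ∀ u, IsFoot lines U x u → u ∈ m

/-- Classicality allows any identification with `PG2 K`, so the distinguishing property must be
expressed by incidence alone. -/
theorem FeetCollinear.of_isIsomorphism {P P' : Type*} {lines : Set (Set P)}
    {lines' : Set (Set P')} {f : P ≃ P'} (hf : IsIsomorphism lines lines' f) {U : Set P}
    (h : FeetCollinear lines' (f '' U)) : FeetCollinear lines U := by
  intro x
  obtain ⟨m, hm, hx⟩ := h (f x)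
  refine ⟨f ⁻¹' m, (hf _).mpr (by rwa [Equiv.image_preimage]), ?_⟩
  rintro u ⟨l, hl, hxl, hlu, hne⟩
  refine hx (f u) ⟨f '' l, (hf l).mp hl, Set.mem_image_of_mem f hxl, ?_, f.injective.ne hne⟩
  rw [← Set.image_inter f.injective, hlu, Set.image_singleton]

variable {K : Type*} [Field K]

/-- The sesquilinear form with matrix `H`. -/
def hermForm (q : ℕ) (H : Matrix (Fin 3) (Fin 3) K) (x y : Fin 3 → K) : K :=
  ∑ i, ∑ j, x i * H i j * y j ^ q

theorem hermForm_smul_add_self {e : ℕ} [CharP K 2] (H : Matrix (Fin 3) (Fin 3) K)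
    (w v : Fin 3 → K) (c : K) :
    hermForm (2 ^ e) H (w + c • v) (w + c • v) =
      hermForm (2 ^ e) H w w + c * hermForm (2 ^ e) H v w + c ^ 2 ^ e * hermForm (2 ^ e) H w v +
        c * c ^ 2 ^ e * hermForm (2 ^ e) H v v := by
  simp only [hermForm, Pi.add_apply, Pi.smul_apply, smul_eq_mul, add_pow_char_pow, mul_pow,
    Fin.sum_univ_three]
  ring

theorem hermForm_smul_smul (q : ℕ) (H : Matrix (Fin 3) (Fin 3) K) (w : Fin 3 → K) (a : K) :
    hermForm q H (a • w) (a • w) = a * a ^ q * hermForm q H w w := by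
  simp only [hermForm, Pi.smul_apply, smul_eq_mul, mul_pow, Fin.sum_univ_three]
  ring

theorem hermForm_conj {e : ℕ} [CharP K 2] (hcard : Nat.card K = 2 ^ e * 2 ^ e)
    {H : Matrix (Fin 3) (Fin 3) K} (hH : ∀ i j, H j i = H i j ^ 2 ^ e) (x y : Fin 3 → K) :
    hermForm (2 ^ e) H x y ^ 2 ^ e = hermForm (2 ^ e) H y x := by
  have hq : ∀ a : K, (a ^ 2 ^ e) ^ 2 ^ e = a := fun a => by
    rw [← pow_mul, ← pow_add]
    exact pow_two_pow_eq_self (by rw [hcard, pow_add]) a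
  unfold hermForm
  simp only [sum_pow_char_pow, mul_pow, hq, ← hH]
  rw [Finset.sum_comm]
  refine Finset.sum_congr rfl fun i _ => Finset.sum_congr rfl fun j _ => ?_
  ring

/-- The line sought is the polar of x. If a foot u were not conjugate to x, the line xu would carry
a second absolute point. -/
theorem feetCollinear_of_isAbsolutePointSet {e : ℕ} [CharP K 2]
    (hcard : Nat.card K = 2 ^ e * 2 ^ e) {ε : K} (hε : ε ^ 2 ^ e = ε + 1) {U : Set (PG2 K)}
    (hU : IsAbsolutePointSet (2 ^ e) U) : FeetCollinear (pgLines K) U := by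
  obtain ⟨H, hH, hdet, hU⟩ := hU
  have h2 : (2 : K) = 0 := CharTwo.two_eq_zero
  have hmem : ∀ p : PG2 K, p ∈ U ↔ hermForm (2 ^ e) H p.rep p.rep = 0 := fun p => by
    rw [hU]; rfl
  intro x
  refine ⟨pgLine (H.mulVec fun j => x.rep j ^ 2 ^ e), ?_, ?_⟩
  · rw [mem_pgLines_iff]
    refine ⟨_, fun h => x.rep_nonzero ?_, rfl⟩
    have h' := Matrix.eq_zero_of_mulVec_eq_zero hdet h
    ext j
    exact eq_zero_of_pow_eq_zero (congrFun h' j)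
  · rintro u ⟨_, ⟨W, hW, rfl⟩, hxW, hlu, hne⟩
    have huW : u ∈ {p : PG2 K | p.submodule ≤ W} ∩ U := by rw [hlu]; rfl
    obtain ⟨huW, huU⟩ := huW
    rw [Set.mem_ofPred_eq, submodule_le_iff_rep_mem] at hxW huW
    rw [hmem] at huU
    set w := x.rep with hw
    set v := u.rep with hv
    have hind : ∀ a : K, w ≠ a • v := by
      intro a ha
      apply hne
      rw [← x.mk_rep, ← u.mk_rep, Projectivization.mk_eq_mk_iff']
      exact ⟨a, ha.symm⟩
    have hvw : hermForm (2 ^ e) H v w = 0 := by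
      by_contra hvw
      -- With N = h(w, w), which is fixed by conjugation, this c makes h(w + cv, w + cv) = N + Nε +
      -- N(ε + 1) = 0.
      set c := hermForm (2 ^ e) H w w * ε / hermForm (2 ^ e) H v w with hc
      have hcv : c * hermForm (2 ^ e) H v w = hermForm (2 ^ e) H w w * ε :=
        div_mul_cancel₀ _ hvw
      have hz : hermForm (2 ^ e) H (w + c • v) (w + c • v) = 0 := by
        rw [hermForm_smul_add_self, huU, mul_zero, add_zero, ← hermForm_conj hcard hH v w,
          ← mul_pow, hcv, mul_pow, hermForm_conj hcard hH, hε]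
        linear_combination (hermForm (2 ^ e) H w w * (1 + ε)) * h2
      have hz0 : w + c • v ≠ 0 := by
        intro h
        exact hind (-c) (by rw [neg_smul]; exact eq_neg_of_add_eq_zero_left h)
      have hzl : (Projectivization.mk K _ hz0 : PG2 K) ∈ ({u} : Set (PG2 K)) := by
        rw [← hlu]
        refine ⟨?_, ?_⟩
        · rw [Set.mem_ofPred_eq, Projectivization.submodule_mk,
            Submodule.span_singleton_le_iff_mem]
          exact W.add_mem hxW (W.smul_mem _ huW)
        · rw [hmem]
          obtain ⟨a, ha⟩ := Projectivization.exists_smul_eq_mk_rep K _ hz0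
          rw [← ha, Units.smul_def, hermForm_smul_smul, hz, mul_zero]
      rw [Set.mem_singleton_iff, ← u.mk_rep, Projectivization.mk_eq_mk_iff'] at hzl
      obtain ⟨a, ha⟩ := hzl
      refine hind (a - c) ?_
      rw [sub_smul, ha, add_sub_cancel_right]
    change _ * _ + _ * _ + _ * _ = _
    rw [← hvw]
    simp only [hermForm, Fin.sum_univ_three, Matrix.mulVec, dotProduct, ← hv]
    ring

end Feet

section NonClassical

variable {F K : Type*} [Field F] [Field K] [Algebra F K] {e : ℕ} {ε b : K}

/-- The foot of the affine point with coordinates `(0, ε)` on a tangent line through it. -/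
theorem isFoot_setUb (hodd : Odd e) (hF : Nat.card F = 2 ^ e) (hK : Module.finrank F K = 2)
    {δ : F} (hTr : absTrace e δ = 1) (hε : ε ∉ Set.range (algebraMap F K))
    (hεδ : ε ^ 2 + ε + algebraMap F K δ = 0) {s t : F} (hst : titsForm e s t = 1) :
    IsFoot (closureLines (planeLines e ε b)) (setUb F e ε b)
      ((closureEquiv e ε b).symm (affinePoint 0 ε))
      ((closureEquiv e ε b).symm (affinePoint (algebraMap F K s + algebraMap F K t * ε)
        (algebraMap F K (s ^ 2 + s * t + t ^ 2 * δ) + ε))) := by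
  have := charP_two_extension (K := K) hF
  have := charP_two_of_card hF
  have h2 : (2 : K) = 0 := CharTwo.two_eq_zero
  have h2F : (2 : F) = 0 := CharTwo.two_eq_zero
  set x := algebraMap F K s + algebraMap F K t * ε with hx
  -- The tangent plane at (s, t) has coefficients m₁ = t, m₀ + m₁ = s and constant f(s, t) = 1, so
  -- the tangent line is y = mx + ε, which passes through (0, ε). Here m = x^q, so mx is the norm s²
  -- + st + t²δ of x.
  set m := algebraMap F K (s + t) + algebraMap F K t * ε with hm
  have hmx : algebraMap F K (s ^ 2 + s * t + t ^ 2 * δ) = m * x := by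
    rw [hm, hx]
    simp only [map_add, map_mul, map_pow]
    linear_combination (-algebraMap F K t ^ 2) * hεδ -
      algebraMap F K t * ε * algebraMap F K s * h2
      + algebraMap F K t ^ 2 * algebraMap F K δ * h2
  have hsymm : ∀ ξ η, (closureEquiv e ε b).symm (affinePoint ξ η) =
      Sum.inl (ξ, titsTerm e ε ξ + b * ξ ^ (2 ^ e + 1) + η) := by
    intro ξ η
    rw [Equiv.symm_apply_eq, closureEquiv_inl]
    congr 1
    ring
  refine ⟨extendLine (planeLines e ε b) (curveD e ε b m ε),
    Or.inl ⟨_, curveD_mem_planeLines m ε, rfl⟩, ?_, ?_, ?_⟩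
  · rw [hsymm, inl_mem_extendLine, mem_curveD_iff]
    ring
  · rw [extendLine_curveD_inter_setUb]
    have hset : {ξ | ∃ r : F, titsTerm e ε ξ + m * ξ + ε = algebraMap F K r} = {x} := by
      ext ξ
      obtain ⟨s', t', rfl⟩ := exists_coord hK hε ξ
      have h := titsTerm_add_mem_range_iff hF hTr hε hεδ (s + t) t 0 1 s' t'
      rw [map_zero, map_one, zero_add, one_mul] at h
      rw [Set.mem_ofPred_eq, h, add_assoc s, CharTwo.add_self_eq_zero, add_zero, ← hst,
        titsForm_eq_tangent_iff hodd hF, Set.mem_singleton_iff]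
      constructor
      · rintro ⟨rfl, rfl⟩
        rfl
      · exact fun h => coord_injective hε h
    rw [hset, Set.image_singleton, hsymm, hmx]
    simp only [add_assoc]
  · rw [hsymm, hsymm]
    intro h
    simp only [Sum.inl.injEq, Prod.mk.injEq] at h
    have h0 := coord_injective hε (s := s) (t := t) (s' := 0) (t' := 0)
      (by rw [← hx, ← h.1]; simp)
    rw [h0.1, h0.2, titsForm_zero_zero] at hst
    exact zero_ne_one hst

theorem not_feetCollinear_setUb (hodd : Odd e) (hF : Nat.card F = 2 ^ e)
    (hK : Module.finrank F K = 2) {δ : F} (hδ : δ ≠ 1) (hTr : absTrace e δ = 1)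
    (hε : ε ∉ Set.range (algebraMap F K)) (hεδ : ε ^ 2 + ε + algebraMap F K δ = 0) :
    ¬ FeetCollinear (closureLines (planeLines e ε b)) (setUb F e ε b) := by
  have := charP_two_of_card hF
  have := charP_two_extension (K := K) hF
  have h2 : (2 : F) = 0 := CharTwo.two_eq_zero
  intro h
  obtain ⟨l, hl, hfeet⟩ := h ((closureEquiv e ε b).symm (affinePoint 0 ε))
  obtain ⟨c, hc, hlc⟩ := (mem_pgLines_iff _).mp ((closureEquiv_isIsomorphism l).mp hl)
  have key : ∀ s t : F, titsForm e s t = 1 →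
      c 0 + c 1 * (algebraMap F K s + algebraMap F K t * ε) +
        c 2 * (algebraMap F K (s ^ 2 + s * t + t ^ 2 * δ) + ε) = 0 := by
    intro s t hst
    have h := Set.mem_image_of_mem (closureEquiv e ε b)
      (hfeet _ (isFoot_setUb hodd hF hK hTr hε hεδ hst))
    rw [Equiv.apply_symm_apply, hlc, affinePoint, mk_mem_pgLine_iff] at h
    simpa using h
  -- The feet have x = ε, 1, 1 + ε with norms δ, 1, δ. The first and last force c₁ = 0, and
  -- comparison with the middle one leaves c₂(δ - 1) = 0.
  have h01 := key 0 1 (by simp [titsForm])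
  have h10 := key 1 0 (by simp [titsForm])
  have h11 := key 1 1 (by simp only [titsForm, one_pow, mul_one]; linear_combination h2)
  have hone : (1 : F) ^ 2 + 1 * 1 + 1 ^ 2 * δ = δ := by linear_combination h2
  rw [hone] at h11
  simp only [map_zero, map_one, zero_add, one_mul, add_zero, mul_zero, zero_mul, one_pow, mul_one,
    ne_eq, OfNat.ofNat_ne_zero, not_false_eq_true, zero_pow] at h01 h10 h11
  have h1 : c 1 = 0 := by linear_combination h11 - h01
  have hδ' : algebraMap F K δ - 1 ≠ 0 := by
    rw [sub_ne_zero, ← map_one (algebraMap F K)]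
    exact (algebraMap F K).injective.ne hδ
  have h2' : c 2 * (algebraMap F K δ - 1) = 0 := by
    linear_combination h01 - h10 - (ε - 1) * h1
  have hc2 : c 2 = 0 := (mul_eq_zero.mp h2').resolve_right hδ'
  have hc0 : c 0 = 0 := by
    linear_combination h10 - h1 - (1 + ε) * hc2
  apply hc
  ext i
  fin_cases i <;> assumption

end NonClassical

/-! ### The Buekenhout-Tits cone -/

section Cone

theorem eq_mk_of_mem_submodule {F V : Type*} [Field F] [AddCommGroup V] [Module F V] {p : ℙ F V}
    {w : V} (hw : w ≠ 0) (h : w ∈ p.submodule) : p = Projectivization.mk F w hw := by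
  rw [Projectivization.submodule_eq, Submodule.mem_span_singleton] at h
  obtain ⟨a, ha⟩ := h
  rw [eq_comm, ← p.mk_rep, Projectivization.mk_eq_mk_iff']
  exact ⟨a, ha⟩

variable {F K : Type*} [Field F] [Field K] [Algebra F K] {e : ℕ} {ε : K}

theorem smul_vec_three (a : F) (x y z : K) : a • ![x, y, z] =
    ![algebraMap F K a * x, algebraMap F K a * y, algebraMap F K a * z] := by
  simp [← Algebra.smul_def]

/-- The frame of the three-space of the base of the cone. -/
def coneFrame (ε : K) : Fin 4 → Fin 3 → K :=
  ![![1, 0, 0], ![0, 1, 0], ![0, ε, 0], ![0, 0, ε]]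

theorem sum_smul_coneFrame (g : Fin 4 → F) : ∑ i, g i • coneFrame ε i =
    ![algebraMap F K (g 0), algebraMap F K (g 1) + algebraMap F K (g 2) * ε,
      algebraMap F K (g 3) * ε] := by
  ext i
  fin_cases i <;> simp [Fin.sum_univ_four, coneFrame, Algebra.smul_def]

theorem linearIndependent_coneFrame (hε : ε ∉ Set.range (algebraMap F K)) :
    LinearIndependent F (coneFrame ε) := by
  rw [Fintype.linearIndependent_iff]
  intro g hg
  rw [sum_smul_coneFrame] at hg
  have h0 : g 0 = 0 := by simpa using congrFun hg 0
  have h1 := coord_injective hε (s := g 1) (t := g 2) (s' := 0) (t' := 0)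
    (by simpa using congrFun hg 1)
  have h3 := coord_injective hε (s := 0) (t := g 3) (s' := 0) (t' := 0)
    (by simpa using congrFun hg 2)
  intro i
  fin_cases i
  exacts [h0, h1.1, h1.2, h3.2]

/-- The line at infinity is x₀ = 0, the base lies in the 3-space of vectors (a, ξ, uε) with a, u in
GF(q), and the vertex (0, 0, 1) lies outside it because ε is not in GF(q). -/
theorem isBTPointSet_setUeps (hF : Nat.card F = 2 ^ e) (hK : Module.finrank F K = 2)
    {δ : F} (hTr : absTrace e δ = 1) (hε : ε ∉ Set.range (algebraMap F K))
    (hεδ : ε ^ 2 + ε + algebraMap F K δ = 0) : IsBTPointSet F e (setUeps F e ε) := by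
  have hε0 : ε ≠ 0 := by
    rintro rfl
    exact hε ⟨0, map_zero _⟩
  let W : Submodule K (Fin 3 → K) := LinearMap.ker (LinearMap.proj 0 : (Fin 3 → K) →ₗ[K] K)
  have hWmem : ∀ w : Fin 3 → K, w ∈ W ↔ w 0 = 0 := fun w => by simp [W]
  have hW : Module.finrank K W = 2 := by
    have h : (LinearMap.proj 0 : Module.Dual K (Fin 3 → K)) ≠ 0 := fun h => by
      simpa using LinearMap.congr_fun h (Pi.single 0 1)
    have hk := Module.Dual.finrank_ker_add_one_of_ne_zero h
    rw [Module.finrank_fin_fun] at hk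
    exact Nat.succ_injective hk
  let S := Submodule.span F (Set.range (coneFrame ε))
  let B := Module.Basis.span (linearIndependent_coneFrame hε)
  have hB : ∀ i, (B i : Fin 3 → K) = coneFrame ε i := fun i => by
    simp [B, Module.Basis.span_apply]
  have hv : (![0, 0, 1] : Fin 3 → K) ≠ 0 := fun h => one_ne_zero (congrFun h 2)
  let v : ℙ F (Fin 3 → K) := Projectivization.mk F ![0, 0, 1] hv
  have hvsub : v.submodule = Submodule.span F {![0, 0, 1]} := Projectivization.submodule_mk _ _
  let O : Set (ℙ F (Fin 3 → K)) := {p | p.submodule = Submodule.span F {![0, 0, ε]} ∨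
    ∃ x : K, p.submodule = Submodule.span F {![1, x, titsTerm e ε x]}}
  -- the vectors of the cone
  have hcone : ∀ x : ℙ F (Fin 3 → K), x ∈ cone v O ↔
      x.rep 0 = 0 ∧ x.rep 1 = 0 ∨
        ∃ (a : F) (ξ : K) (r : F), x.rep = a • ![1, ξ, titsTerm e ε ξ + algebraMap F K r] := by
    intro x
    constructor
    · rintro ⟨o, ho, hx⟩
      rw [submodule_le_iff_rep_mem, hvsub] at hx
      rcases ho with ho | ⟨ξ, ho⟩
      · rw [ho, ← Submodule.span_union, Set.singleton_union, Submodule.mem_span_pair] at hx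
        obtain ⟨a, c, h⟩ := hx
        rw [← h]
        left
        constructor <;> simp
      · rw [ho, ← Submodule.span_union, Set.singleton_union, Submodule.mem_span_pair] at hx
        obtain ⟨a, c, h⟩ := hx
        rw [← h]
        by_cases hc : c = 0
        · left
          subst hc
          constructor <;> simp
        · right
          -- Normalising the combination a(0, 0, 1) + c(1, ξ, g(ξ)) to first coordinate 1 leaves r =
          -- a/c.
          refine ⟨c, ξ, a / c, ?_⟩
          have hc' : algebraMap F K c ≠ 0 := by simpa using hc
          ext i
          fin_cases i
          · simp
          · simp
          · simp only [smul_vec_three, Fin.reduceFinMk, Pi.add_apply, Matrix.cons_val, map_div₀]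
            field_simp
            ring
    · rintro (⟨h0, h1⟩ | ⟨a, ξ, r, h⟩)
      · have hw : (![0, 0, ε] : Fin 3 → K) ≠ 0 := fun h => hε0 (congrFun h 2)
        refine ⟨Projectivization.mk F _ hw, Or.inl (Projectivization.submodule_mk _ _), ?_⟩
        rw [submodule_le_iff_rep_mem, hvsub, Projectivization.submodule_mk,
          ← Submodule.span_union, Set.singleton_union, Submodule.mem_span_pair]
        -- The vertex and the ovoid point (0, 0, ε) span all (0, 0, z), since 1, ε is a basis over
        -- GF(q); this generator is the spread line at infinity.
        obtain ⟨s, t, hst⟩ := exists_coord hK hε (x.rep 2)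
        refine ⟨s, t, ?_⟩
        ext i
        fin_cases i
        · simp [h0]
        · simp [h1]
        · simp [hst, Algebra.smul_def]
      · have hw : (![1, ξ, titsTerm e ε ξ] : Fin 3 → K) ≠ 0 :=
          fun h => one_ne_zero (congrFun h 0)
        refine ⟨Projectivization.mk F _ hw, Or.inr ⟨ξ, Projectivization.submodule_mk _ _⟩, ?_⟩
        rw [submodule_le_iff_rep_mem, hvsub, Projectivization.submodule_mk,
          ← Submodule.span_union, Set.singleton_union, Submodule.mem_span_pair]
        refine ⟨a * r, a, ?_⟩
        rw [h]
        ext i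
        fin_cases i
        · simp
        · simp
        · simp only [smul_vec_three, Fin.reduceFinMk, Pi.add_apply, Matrix.cons_val, map_mul]
          ring
  refine ⟨W, ![1, 0, 0], S, O, v, pgPointY, hW, by simp [hWmem], ?_, ⟨B, ?_⟩, ?_, ?_, ?_, ?_, ?_⟩
  · refine Submodule.span_le.mpr ?_
    rintro _ ⟨i, rfl⟩
    fin_cases i
    · exact Submodule.mem_sup_right (Submodule.mem_span_singleton_self _)
    all_goals
      refine Submodule.mem_sup_left ?_
      rw [Submodule.restrictScalars_mem, hWmem]
      simp [coneFrame]
  · have hfr : ∀ s t u : F, coneFrame ε 0 + s • coneFrame ε 1 + t • coneFrame ε 2 +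
        u • coneFrame ε 3 =
        ![1, algebraMap F K s + algebraMap F K t * ε, algebraMap F K u * ε] := by
      intro s t u
      ext i
      fin_cases i <;> simp [coneFrame]
      · simp [Algebra.smul_def]
      · simp [Algebra.smul_def]
    simp only [hB, hfr]
    ext p
    refine or_congr_right ?_
    constructor
    · rintro ⟨x, h⟩
      obtain ⟨s, t, rfl⟩ := exists_coord hK hε x
      exact ⟨s, t, by rw [h, titsTerm_coord hF hTr hεδ]; rfl⟩
    · rintro ⟨s, t, h⟩
      exact ⟨algebraMap F K s + algebraMap F K t * ε, by
        rw [h, titsTerm_coord hF hTr hεδ]; rfl⟩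
  · rw [hvsub, Submodule.span_singleton_le_iff_mem, Submodule.restrictScalars_mem, hWmem]
    rfl
  · rw [hvsub, Submodule.span_singleton_le_iff_mem, Submodule.mem_span_range_iff_exists_fun]
    rintro ⟨g, hg⟩
    rw [sum_smul_coneFrame] at hg
    have h3 := coord_injective hε (s := 0) (t := g 3) (s' := 1) (t' := 0)
      (by simpa using congrFun hg 2)
    exact zero_ne_one h3.1
  · rw [pgPointY, Projectivization.submodule_mk, Submodule.span_singleton_le_iff_mem, hWmem]
    rfl
  · ext x
    rw [Set.mem_ofPred_eq, Set.mem_ofPred_eq, hcone, submodule_le_iff_rep_mem,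
      submodule_le_iff_rep_mem, Submodule.restrictScalars_mem, Submodule.restrictScalars_mem,
      hWmem, pgPointY, Projectivization.submodule_mk, Submodule.mem_span_singleton]
    constructor
    · rintro ⟨⟨h0, h1⟩ | ⟨a, ξ, r, h⟩, h0'⟩
      · refine ⟨x.rep 2, ?_⟩
        ext i
        fin_cases i <;> simp [h0, h1]
      · exfalso
        rw [h] at h0'
        have ha : a = 0 := by simpa [Algebra.smul_def] using h0'
        exact x.rep_nonzero (by rw [h, ha, zero_smul])
    · rintro ⟨a, h⟩
      rw [← h]
      simp
  · ext p
    constructor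
    · rintro (⟨ξ, r, rfl⟩ | rfl)
      · have hw : (![1, ξ, titsTerm e ε ξ + algebraMap F K r] : Fin 3 → K) ≠ 0 :=
          fun h => one_ne_zero (congrFun h 0)
        refine ⟨Projectivization.mk F _ hw, ?_, ?_⟩
        · rw [hcone]
          right
          obtain ⟨a, ha⟩ := Projectivization.exists_smul_eq_mk_rep F _ hw
          exact ⟨a, ξ, r, by rw [← ha, Units.smul_def]⟩
        · rw [Projectivization.submodule_mk, Submodule.span_singleton_le_iff_mem,
            Submodule.restrictScalars_mem, affinePoint, Projectivization.submodule_mk]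
          exact Submodule.mem_span_singleton_self _
      · refine ⟨v, ?_, ?_⟩
        · rw [hcone]
          left
          obtain ⟨a, ha⟩ := Projectivization.exists_smul_eq_mk_rep F _ hv
          rw [← ha]
          simp
        · rw [hvsub, Submodule.span_singleton_le_iff_mem, Submodule.restrictScalars_mem, pgPointY,
            Projectivization.submodule_mk]
          exact Submodule.mem_span_singleton_self _
    · rintro ⟨x, hx, hxp⟩
      rw [submodule_le_iff_rep_mem, Submodule.restrictScalars_mem] at hxp
      rw [eq_mk_of_mem_submodule x.rep_nonzero hxp]
      rcases (hcone x).mp hx with ⟨h0, h1⟩ | ⟨a, ξ, r, h⟩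
      · right
        rw [pgPointY, Projectivization.mk_eq_mk_iff']
        refine ⟨x.rep 2, ?_⟩
        ext i
        fin_cases i <;> simp [h0, h1]
      · left
        refine ⟨ξ, r, ?_⟩
        rw [affinePoint, Projectivization.mk_eq_mk_iff']
        exact ⟨algebraMap F K a, by rw [h, algebraMap_smul]⟩

end Cone

end Unitals

open Unitals
theorem theorem3p5 {F K : Type*} [Field F] [Field K] [Algebra F K]
    (e : ℕ) (he : 1 < e) (hodd : Odd e)
    (hF : Nat.card F = 2 ^ e) (hK : Module.finrank F K = 2)
    (δ : F) (hδ : δ ≠ 1) (hTr : absTrace e δ = 1)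
    (ε : K) (hε : ε ∉ Set.range (algebraMap F K))
    (hεδ : ε ^ 2 + ε + algebraMap F K δ = 0)
    (b : K) (hb : b ∉ Set.range (algebraMap F K)) :
    (∃ f : ClosurePoint (planeLines e ε b) ≃ PG2 K,
      IsIsomorphism (closureLines (planeLines e ε b)) (pgLines K) f ∧
      (∀ ξ η : K, f (Sum.inl (ξ, η + titsTerm e ε ξ + b * ξ ^ (2 ^ e + 1))) = affinePoint ξ η) ∧
      f (pointY e ε b) = pgPointY ∧
      f '' setUb F e ε b = setUeps F e ε) ∧
    IsBTUnital F K e (closureLines (planeLines e ε b)) (setUb F e ε b) ∧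
    ¬ IsClassicalUnital K (2 ^ e) (closureLines (planeLines e ε b)) (setUb F e ε b) := by
  have := charP_two_extension (K := K) hF
  refine ⟨⟨closureEquiv e ε b, closureEquiv_isIsomorphism, closureEquiv_apply_affine,
    closureEquiv_pointY, closureEquiv_image_setUb⟩,
    ⟨isUnital_setUb (by omega) hodd hF hK hTr hε hεδ, closureEquiv e ε b,
      closureEquiv_isIsomorphism, ?_⟩, ?_⟩
  · rw [closureEquiv_image_setUb]
    exact isBTPointSet_setUeps hF hK hTr hε hεδ
  · rintro ⟨f, hf, hU⟩
    exact not_feetCollinear_setUb hodd hF hK hδ hTr hε hεδ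
      (FeetCollinear.of_isIsomorphism hf (feetCollinear_of_isAbsolutePointSet
        (natCard_extension hF hK) (pow_card_eq_add_one hF hTr hεδ) hU))
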